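/- Conventions. A function $F:[0,\infty)^4\to[0,\infty)$ is permissible if it is nondecreasing in each variable and $x\,l_y+y\,l_x\le F(x,y,l_x,l_y)$ for all $x,y,l_x,l_y\ge 0$. For a nonzero unital C*-algebra $\mathfrak A$, let $\mathfrak{sa}(\mathfrak A)$ be its real subspace of self-adjoint elements and $\mathscr S(\mathfrak A)$ its state space. An $F$-quasi-Leibniz quantum compact metric space is a pair $(\mathfrak A,L)$ of such an algebra and a seminorm $L$ on a dense real subspace $\mathrm{dom}(L)$ of $\mathfrak{sa}(\mathfrak A)$ that is closed under $a\circ b=\frac12(ab+ba)$ and $\{a,b\}=\frac1{2i}(ab-ba)$ (put $L=\infty$ off $\mathrm{dom}(L)$), such that: (1) $\{a: L(a)=0\}=\mathbb R 1_{\mathfrak A}$; (2) $\{a\in\mathfrak{sa}(\mathfrak A): L(a)\le 1\}$ is norm closed; (3) $\mathsf{mk}_L(\varphi,\psi)=\sup\{|\varphi(a)-\psi(a)|: L(a)\le1\}$ is a metric on $\mathscr S(\mathfrak A)$ that induces the weak* topology; (4) $L(a\circ b)$ and $L(\{a,b\})$ are at most $F(\|a\|,\|b\|,L(a),L(b))$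 for all $a,b\in\mathrm{dom}(L)$. An $F$-tunnel $(\mathfrak D,L_{\mathfrak D},\pi_1,\pi_2)$ from $(\mathfrak A_1,L_1)$ to $(\mathfrak A_2,L_2)$ is an $F$-quasi-Leibniz quantum compact metric space $(\mathfrak D,L_{\mathfrak D})$ with surjective *-homomorphisms $\pi_j:\mathfrak D\to\mathfrak A_j$ such that $L_j(a)=\inf\{L_{\mathfrak D}(d): d\in\mathfrak{sa}(\mathfrak D),\ \pi_j(d)=a\}$ for all $a\in\mathfrak{sa}(\mathfrak A_j)$, $j=1,2$. Its extent is the maximum over $j\in\{1,2\}$ of the Hausdorff distance, for $\mathsf{mk}_{L_{\mathfrak D}}$, between $\mathscr S(\mathfrak D)$ and $\{\varphi\circ\pi_j:\varphi\in\mathscr S(\mathfrak A_j)\}$. Proposition. Let $F$ be permissible, let $(\mathfrak A,L_{\mathfrak A})$ and $(\mathfrak B,L_{\mathfrak B})$ be $F$-quasi-Leibniz quantum compact metric spaces with $\mathfrak A,\mathfrak B\neq 0$, and let $D=\max\{\mathrm{diam}(\mathscr S(\mathfrak A),\mathsf{mk}_{L_{\mathfrak A}}),\mathrm{diam}(\mathscr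 S(\mathfrak B),\mathsf{mk}_{L_{\mathfrak B}})\}$. Then $D<\infty$, and for every $\varepsilon\ge0$ with $D+\varepsilon>0$ there is an $F$-tunnel from $(\mathfrak A,L_{\mathfrak A})$ to $(\mathfrak B,L_{\mathfrak B})$ of extent at most $D+\varepsilon$. More precisely, let $\mathscr H$ be any separable infinite-dimensional complex Hilbert space. Then $\mathfrak A$ and $\mathfrak B$ both have faithful unital representations on $\mathscr H$, and for all faithful unital representations $\pi_{\mathfrak A}$, $\pi_{\mathfrak B}$ of them on $\mathscr H$ and every $\varepsilon\ge0$ with $D+\varepsilon>0$, the algebra $\mathfrak A\oplus\mathfrak B$ with $$L(a,b)=\max\Big\{L_{\mathfrak A}(a),\,L_{\mathfrak B}(b),\,\tfrac1{D+\varepsilon}\|\pi_{\mathfrak A}(a)-\pi_{\mathfrak B}(b)\|\Big\}$$ and the two coordinate projections is an $F$-tunnel from $(\mathfrak A,L_{\mathfrak A})$ to $(\mathfrak B,L_{\mathfrak B})$ of extent at most $D+\varepsilon$. -/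

import Mathlib

open scoped NNReal ENNReal ComplexOrder

universe u v w

namespace QuantumMetric

/-- A state of a unital C*-algebra: a positive linear functional mapping `1` to `1`. -/
def IsState {A : Type*} [CStarAlgebra A] (φ : WeakDual ℂ A) : Prop :=
  φ 1 = 1 ∧ ∀ a : A, 0 ≤ φ (star a * a)

/-- The state space, with the (subspace) weak* topology. -/
abbrev StateSpace (A : Type*) [CStarAlgebra A] : Type _ :=
  {φ : WeakDual ℂ A // IsState φ}

/-- The Jordan product `(ab + ba) / 2` of two self-adjoint elements. -/
noncomputable def jordanProd {A : Type*} [CStarAlgebra A] (a b : selfAdjoint A) : selfAdjoint A :=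
  ⟨(1 / 2 : ℂ) • ((a : A) * b + b * a), by
    rw [selfAdjoint.mem_iff, star_smul, star_add, star_mul, star_mul,
      selfAdjoint.star_val_eq, selfAdjoint.star_val_eq, add_comm]
    simp⟩

/-- The Lie product `(ab - ba) / (2i)` of two self-adjoint elements. -/
noncomputable def lieProd {A : Type*} [CStarAlgebra A] (a b : selfAdjoint A) : selfAdjoint A :=
  ⟨(1 / (2 * Complex.I) : ℂ) • ((a : A) * b - b * a), by
    rw [selfAdjoint.mem_iff, star_smul, star_sub, star_mul, star_mul,
      selfAdjoint.star_val_eq, selfAdjoint.star_val_eq, ← neg_sub, smul_neg, ← neg_smul]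
    congr 1
    simp⟩

/-- A seminorm defined on a real subspace of the self-adjoint part of `A`, extended by the value
`∞` outside of that subspace (with `0 * ∞ = 0`). -/
structure PartialSeminorm (A : Type*) [CStarAlgebra A] where
  toFun : selfAdjoint A → ℝ≥0∞
  smul' : ∀ (r : ℝ) (a : selfAdjoint A), toFun (r • a) = ‖r‖ₑ * toFun a
  add_le' : ∀ a b : selfAdjoint A, toFun (a + b) ≤ toFun a + toFun b

instance {A : Type*} [CStarAlgebra A] :
    CoeFun (PartialSeminorm A) (fun _ => selfAdjoint A → ℝ≥0∞) := ⟨PartialSeminorm.toFun⟩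

/-- The domain of a partially defined seminorm: the real subspace where it is finite. -/
def PartialSeminorm.dom {A : Type*} [CStarAlgebra A] (L : PartialSeminorm A) :
    Submodule ℝ (selfAdjoint A) where
  carrier := {a | L a < ∞}
  zero_mem' := by
    have h := L.smul' 0 0
    simp only [smul_zero, enorm_zero, zero_mul] at h
    simp [h]
  add_mem' := fun {a b} ha hb =>
    lt_of_le_of_lt (L.add_le' a b) (ENNReal.add_lt_top.2 ⟨ha, hb⟩)
  smul_mem' := fun r a ha => by
    simp only [Set.mem_ofPred_eq, L.smul'] at ha ⊢
    exact ENNReal.mul_lt_top enorm_lt_top ha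

/-- The Monge-Kantorovich distance between states:
`sup {|φ(a) - ψ(a)| : L(a) ≤ 1}`, a priori with values in `[0, ∞]`. -/
noncomputable def mkDist {A : Type*} [CStarAlgebra A] (L : PartialSeminorm A)
    (φ ψ : StateSpace A) : ℝ≥0∞ :=
  ⨆ (a : selfAdjoint A) (_ : L a ≤ 1), ‖φ.1 (a : A) - ψ.1 (a : A)‖ₑ

/-- The Monge-Kantorovich distance as an extended pseudo-metric, with the topology it induces. -/
@[reducible] noncomputable def mkMetric {A : Type*} [CStarAlgebra A] (L : PartialSeminorm A) :
    PseudoEMetricSpace (StateSpace A) where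
  edist := mkDist L
  edist_self φ := by simp [mkDist]
  edist_comm φ ψ := by
    simp only [mkDist]
    refine iSup_congr fun a => iSup_congr fun _ => ?_
    rw [← enorm_neg, neg_sub]
  edist_triangle φ ψ θ := by
    refine iSup₂_le fun a ha => ?_
    rw [← sub_add_sub_cancel (φ.1 (a : A)) (ψ.1 (a : A)) (θ.1 (a : A))]
    refine (enorm_add_le _ _).trans (add_le_add ?_ ?_)
    · exact le_iSup₂_of_le a ha le_rfl
    · exact le_iSup₂_of_le a ha le_rfl

/-- The diameter of the state space for the Monge-Kantorovich metric. -/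
noncomputable def stateDiam {A : Type*} [CStarAlgebra A] (L : PartialSeminorm A) : ℝ≥0∞ :=
  @Metric.ediam (StateSpace A) (mkMetric L) Set.univ

/-- The Hausdorff distance on sets of states for the Monge-Kantorovich metric. -/
noncomputable def mkHausdorff {A : Type*} [CStarAlgebra A] (L : PartialSeminorm A)
    (s t : Set (StateSpace A)) : ℝ≥0∞ :=
  @Metric.hausdorffEDist (StateSpace A) (mkMetric L) s t

/-- Permissible functions `F : [0, ∞)⁴ → [0, ∞)`. -/
structure IsPermissible (F : ℝ≥0 → ℝ≥0 → ℝ≥0 → ℝ≥0 → ℝ≥0) : Prop where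
  mono : ∀ x₁ x₂ x₃ x₄ y₁ y₂ y₃ y₄ : ℝ≥0, x₁ ≤ y₁ → x₂ ≤ y₂ → x₃ ≤ y₃ → x₄ ≤ y₄ →
    F x₁ x₂ x₃ x₄ ≤ F y₁ y₂ y₃ y₄
  le : ∀ x y lx ly : ℝ≥0, x * ly + y * lx ≤ F x y lx ly

/-- The `F`-quasi-Leibniz property on the domain of `L`. -/
def IsQuasiLeibniz {A : Type*} [CStarAlgebra A] (F : ℝ≥0 → ℝ≥0 → ℝ≥0 → ℝ≥0 → ℝ≥0)
    (L : PartialSeminorm A) : Prop :=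
  ∀ a ∈ L.dom, ∀ b ∈ L.dom,
    L (jordanProd a b) ≤ F ‖(a : A)‖₊ ‖(b : A)‖₊ (L a).toNNReal (L b).toNNReal ∧
    L (lieProd a b) ≤ F ‖(a : A)‖₊ ‖(b : A)‖₊ (L a).toNNReal (L b).toNNReal

/-- `(A, L)` is an `F`-quasi-Leibniz quantum compact metric space. -/
structure IsQuantumCompactMetricSpace {A : Type*} [CStarAlgebra A]
    (F : ℝ≥0 → ℝ≥0 → ℝ≥0 → ℝ≥0 → ℝ≥0) (L : PartialSeminorm A) : Prop where
  dense_dom : Dense (L.dom : Set (selfAdjoint A))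
  jordan_mem : ∀ a ∈ L.dom, ∀ b ∈ L.dom, jordanProd a b ∈ L.dom
  lie_mem : ∀ a ∈ L.dom, ∀ b ∈ L.dom, lieProd a b ∈ L.dom
  ker : {a : selfAdjoint A | L a = 0} = Set.range fun r : ℝ => r • (1 : selfAdjoint A)
  closed : IsClosed {a : selfAdjoint A | L a ≤ 1}
  mk_finite : ∀ φ ψ : StateSpace A, mkDist L φ ψ < ∞
  mk_topology : (mkMetric L).toUniformSpace.toTopologicalSpace =
    (inferInstance : TopologicalSpace (StateSpace A))
  quasiLeibniz : IsQuasiLeibniz F L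

/-- The restriction of a unital *-homomorphism to the self-adjoint parts. -/
def saMap {D A : Type*} [CStarAlgebra D] [CStarAlgebra A] (π : D →⋆ₐ[ℂ] A)
    (d : selfAdjoint D) : selfAdjoint A :=
  ⟨π d, by rw [selfAdjoint.mem_iff, ← map_star, selfAdjoint.star_val_eq]⟩

/-- The dual map `φ ↦ φ ∘ π` on state spaces. -/
noncomputable def dualMap {D A : Type*} [CStarAlgebra D] [CStarAlgebra A] (π : D →⋆ₐ[ℂ] A)
    (φ : StateSpace A) : StateSpace D :=
  ⟨StrongDual.toWeakDual ((WeakDual.toStrongDual φ.1).comp ⟨(π : D →ₗ[ℂ] A),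
    AddMonoidHomClass.continuous_of_bound π 1
      (by simpa using NonUnitalStarAlgHom.norm_apply_le π)⟩), by
    refine ⟨?_, fun d => ?_⟩
    · change φ.1 (π 1) = 1
      rw [map_one]
      exact φ.2.1
    · have h := φ.2.2 (π d)
      rw [← map_star, ← map_mul] at h
      exact h⟩

/-- `(D, L, π₁, π₂)` is an `F`-tunnel from `(A, LA)` to `(B, LB)`: it is an `F`-quasi-Leibniz
quantum compact metric space, `π₁` and `π₂` are *-epimorphisms, and `LA` and `LB` are the quotients
of `L` along them. (A surjective *-homomorphism between unital algebras is unital.) -/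
structure IsTunnel {A B D : Type*} [CStarAlgebra A] [CStarAlgebra B] [CStarAlgebra D]
    (F : ℝ≥0 → ℝ≥0 → ℝ≥0 → ℝ≥0 → ℝ≥0) (LA : PartialSeminorm A) (LB : PartialSeminorm B)
    (L : PartialSeminorm D) (π₁ : D →⋆ₐ[ℂ] A) (π₂ : D →⋆ₐ[ℂ] B) : Prop where
  space : IsQuantumCompactMetricSpace F L
  surj₁ : Function.Surjective π₁
  surj₂ : Function.Surjective π₂
  quotient₁ : ∀ a : selfAdjoint A, LA a = ⨅ (d : selfAdjoint D) (_ : saMap π₁ d = a), L d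
  quotient₂ : ∀ b : selfAdjoint B, LB b = ⨅ (d : selfAdjoint D) (_ : saMap π₂ d = b), L d

/-- The extent of a tunnel `(D, L, π₁, π₂)`. -/
noncomputable def extent {A B D : Type*} [CStarAlgebra A] [CStarAlgebra B] [CStarAlgebra D]
    (L : PartialSeminorm D) (π₁ : D →⋆ₐ[ℂ] A) (π₂ : D →⋆ₐ[ℂ] B) : ℝ≥0∞ :=
  max (mkHausdorff L Set.univ (Set.range (dualMap π₁)))
    (mkHausdorff L Set.univ (Set.range (dualMap π₂)))

/-- The seminorm `(a, b) ↦ max {LA(a), LB(b), ‖πA(a) - πB(b)‖ / r}` on `A ⊕ B`, for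
representations `πA` and `πB` on a common Hilbert space. -/
noncomputable def glue {A B : Type*} [CStarAlgebra A] [CStarAlgebra B]
    {H : Type*} [NormedAddCommGroup H] [InnerProductSpace ℂ H] [CompleteSpace H]
    (LA : PartialSeminorm A) (LB : PartialSeminorm B)
    (πA : A →⋆ₐ[ℂ] (H →L[ℂ] H)) (πB : B →⋆ₐ[ℂ] (H →L[ℂ] H)) (r : ℝ≥0∞) :
    PartialSeminorm (A × B) where
  toFun x := max (max (LA (saMap (StarAlgHom.fst ℂ A B) x)) (LB (saMap (StarAlgHom.snd ℂ A B) x)))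
    (‖πA (x : A × B).1 - πB (x : A × B).2‖ₑ / r)
  smul' c x := by
    have h1 : saMap (StarAlgHom.fst ℂ A B) (c • x) = c • saMap (StarAlgHom.fst ℂ A B) x := rfl
    have h2 : saMap (StarAlgHom.snd ℂ A B) (c • x) = c • saMap (StarAlgHom.snd ℂ A B) x := rfl
    have h3 : πA ((c • x : selfAdjoint (A × B)) : A × B).1
        - πB ((c • x : selfAdjoint (A × B)) : A × B).2
        = (c : ℂ) • (πA (x : A × B).1 - πB (x : A × B).2) := by
      have e1 : ((c • x : selfAdjoint (A × B)) : A × B).1 = (c : ℂ) • (x : A × B).1 := by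
        rw [Complex.coe_smul]; rfl
      have e2 : ((c • x : selfAdjoint (A × B)) : A × B).2 = (c : ℂ) • (x : A × B).2 := by
        rw [Complex.coe_smul]; rfl
      rw [e1, e2, map_smul, map_smul, smul_sub]
    have h4 : ‖(c : ℂ)‖ₑ = ‖c‖ₑ := by
      rw [← ofReal_norm, ← ofReal_norm, Complex.norm_real]
    rw [h1, h2, h3, LA.smul', LB.smul', enorm_smul, h4, mul_div_assoc, mul_max, mul_max]
  add_le' x y := by
    have h1 : saMap (StarAlgHom.fst ℂ A B) (x + y)
        = saMap (StarAlgHom.fst ℂ A B) x + saMap (StarAlgHom.fst ℂ A B) y := rfl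
    have h2 : saMap (StarAlgHom.snd ℂ A B) (x + y)
        = saMap (StarAlgHom.snd ℂ A B) x + saMap (StarAlgHom.snd ℂ A B) y := rfl
    have h3 : πA ((x + y : selfAdjoint (A × B)) : A × B).1
        - πB ((x + y : selfAdjoint (A × B)) : A × B).2
        = (πA (x : A × B).1 - πB (x : A × B).2) + (πA (y : A × B).1 - πB (y : A × B).2) := by
      have e1 : ((x + y : selfAdjoint (A × B)) : A × B).1 = (x : A × B).1 + (y : A × B).1 := rfl
      have e2 : ((x + y : selfAdjoint (A × B)) : A × B).2 = (x : A × B).2 + (y : A × B).2 := rfl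
      rw [e1, e2, map_add, map_add, add_sub_add_comm]
    rw [h1, h2, h3]
    refine max_le (max_le ?_ ?_) ?_
    · exact (LA.add_le' _ _).trans
        (add_le_add (le_max_of_le_left (le_max_left _ _)) (le_max_of_le_left (le_max_left _ _)))
    · exact (LB.add_le' _ _).trans
        (add_le_add (le_max_of_le_left (le_max_right _ _)) (le_max_of_le_left (le_max_right _ _)))
    · refine (ENNReal.div_le_div_right (enorm_add_le _ _) r).trans ?_
      rw [ENNReal.add_div]
      exact add_le_add (le_max_right _ _) (le_max_right _ _)

end QuantumMetric

open QuantumMetric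

/-!
The Lip-norm `max (LA a) (LB b) (‖πA a - πB b‖ / r)` glues the two state spaces with `r` as a
bridge. Because `r` dominates both diameters, every `a` lies within `r * LA a` of a scalar, so
pairing `a` with that scalar lifts `a` to `A × B` without increasing its Lip-norm: both coordinate
maps are quotient maps for the Lip-norms. The Lip-ball of `A × B` modulo scalars is a closed subset
of a compact set, which yields the weak* topology.

For the extent, faithful `πA` and `πB` embed `A × B` in `𝓑(H) × 𝓑(H)`. A state of `A × B` extends to
a state there, and evaluating the extension at `(πA a, πA a)` instead of `(πA a, πB b)` gives a
state of `A` and changes the value by at most `‖πA a - πB b‖ ≤ r` when `L (a, b) ≤ 1`.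

A Lip-norm makes the state space compact metrizable, hence the algebra separable, and the Hilbert
sum of the GNS representations of states norming a dense sequence is then faithful on a separable
infinite-dimensional space.
-/

namespace QuantumMetric

section States

variable {A : Type*} [CStarAlgebra A]

attribute [local instance] CStarAlgebra.spectralOrder CStarAlgebra.spectralOrderedRing

namespace StateSpace

lemma map_one (φ : StateSpace A) : φ.1 1 = 1 := φ.2.1

/-- A state as a positive linear map, to which Mathlib's GNS construction applies. -/
noncomputable def toPositive (φ : StateSpace A) : A →ₚ[ℂ] ℂ :=
  PositiveLinearMap.mk₀ ((WeakDual.toStrongDual φ.1 : A →L[ℂ] ℂ) : A →ₗ[ℂ] ℂ) fun a ha => by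
    obtain ⟨b, rfl⟩ := CStarAlgebra.nonneg_iff_eq_star_mul_self.1 ha
    exact φ.2.2 b

@[simp] lemma toPositive_apply (φ : StateSpace A) (a : A) : φ.toPositive a = φ.1 a := rfl

lemma im_apply_eq_zero (φ : StateSpace A) {a : A} (ha : IsSelfAdjoint a) : (φ.1 a).im = 0 := by
  have hstar := map_star φ.toPositive a
  rw [ha.star_eq] at hstar
  exact Complex.conj_eq_iff_im.1 hstar.symm

/-- The cyclic unit vector of the GNS representation of a state. -/
noncomputable def cyclicVector (φ : StateSpace A) : φ.toPositive.GNS :=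
  (φ.toPositive.toPreGNS 1 : φ.toPositive.PreGNS)

lemma gnsStarAlgHom_cyclicVector (φ : StateSpace A) (a : A) :
    φ.toPositive.gnsStarAlgHom a φ.cyclicVector = (φ.toPositive.toPreGNS a : φ.toPositive.GNS) := by
  simp [cyclicVector]

lemma inner_gnsStarAlgHom_cyclicVector (φ : StateSpace A) (a b : A) :
    inner ℂ (φ.toPositive.gnsStarAlgHom a φ.cyclicVector)
      (φ.toPositive.gnsStarAlgHom b φ.cyclicVector) = φ.1 (star a * b) := by
  rw [gnsStarAlgHom_cyclicVector, gnsStarAlgHom_cyclicVector, UniformSpace.Completion.inner_coe,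
    PositiveLinearMap.preGNS_inner_def, toPositive_apply]
  rfl

lemma norm_gnsStarAlgHom_cyclicVector_sq (φ : StateSpace A) (a : A) :
    ‖φ.toPositive.gnsStarAlgHom a φ.cyclicVector‖ ^ 2 = (φ.1 (star a * a)).re := by
  rw [← inner_gnsStarAlgHom_cyclicVector, inner_self_eq_norm_sq_to_K]
  norm_cast

lemma norm_cyclicVector (φ : StateSpace A) : ‖φ.cyclicVector‖ = 1 := by
  have hsq := φ.norm_gnsStarAlgHom_cyclicVector_sq 1
  rw [_root_.map_one, one_apply_eq_self, star_one, one_mul, φ.map_one,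
    Complex.one_re] at hsq
  exact (pow_eq_one_iff_of_nonneg (norm_nonneg _) two_ne_zero).1 hsq

instance (φ : StateSpace A) : Nontrivial φ.toPositive.GNS :=
  ⟨φ.cyclicVector, 0, norm_ne_zero_iff.1 (φ.norm_cyclicVector ▸ one_ne_zero)⟩

lemma norm_gnsStarAlgHom_cyclicVector_le (φ : StateSpace A) (a : A) :
    ‖φ.toPositive.gnsStarAlgHom a φ.cyclicVector‖ ≤ ‖φ.toPositive.gnsStarAlgHom a‖ := by
  simpa only [φ.norm_cyclicVector, mul_one] using
    (φ.toPositive.gnsStarAlgHom a).le_opNorm φ.cyclicVector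

instance [TopologicalSpace.SeparableSpace A] (φ : StateSpace A) :
    TopologicalSpace.SeparableSpace φ.toPositive.GNS := by
  have hdense : DenseRange fun a => φ.toPositive.gnsStarAlgHom a φ.cyclicVector := by
    simp only [gnsStarAlgHom_cyclicVector]
    exact UniformSpace.Completion.denseRange_coe.comp φ.toPositive.toPreGNS.surjective.denseRange
      (UniformSpace.Completion.continuous_coe _)
  exact hdense.separableSpace ((map_continuous φ.toPositive.gnsStarAlgHom).clm_apply
    continuous_const)

lemma norm_apply_le (φ : StateSpace A) (a : A) : ‖φ.1 a‖ ≤ ‖a‖ :=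
  calc ‖φ.1 a‖ = ‖inner ℂ φ.cyclicVector (φ.toPositive.gnsStarAlgHom a φ.cyclicVector)‖ := by
        simpa using congrArg norm (φ.inner_gnsStarAlgHom_cyclicVector 1 a).symm
    _ ≤ ‖φ.cyclicVector‖ * ‖φ.toPositive.gnsStarAlgHom a φ.cyclicVector‖ := norm_inner_le_norm _ _
    _ ≤ ‖φ.toPositive.gnsStarAlgHom a‖ := by
        rw [φ.norm_cyclicVector, one_mul]
        exact φ.norm_gnsStarAlgHom_cyclicVector_le a
    _ ≤ ‖a‖ := NonUnitalStarAlgHom.norm_apply_le φ.toPositive.gnsStarAlgHom a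

lemma continuous_eval (a : A) : Continuous fun φ : StateSpace A => φ.1 a :=
  (WeakDual.eval_continuous a).comp continuous_subtype_val

lemma ext_selfAdjoint {φ ψ : StateSpace A}
    (h : ∀ a : selfAdjoint A, φ.1 (a : A) = ψ.1 (a : A)) : φ = ψ := by
  refine Subtype.ext (DFunLike.ext _ _ fun a => ?_)
  rw [← realPart_add_I_smul_imaginaryPart a]
  simp only [map_add, map_smul, h]

end StateSpace

instance : CompactSpace (StateSpace A) := by
  have hclosed : IsClosed {φ : WeakDual ℂ A | IsState φ} := by
    simp only [IsState, Set.ofPred_and, Set.ofPred_forall]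
    exact (isClosed_eq (WeakDual.eval_continuous 1) continuous_const).inter
      (isClosed_iInter fun a => isClosed_le continuous_const (WeakDual.eval_continuous _))
  refine isCompact_iff_compactSpace.1
    ((WeakDual.isCompact_closedBall (𝕜 := ℂ) 0 1).of_isClosed_subset hclosed fun φ hφ => ?_)
  rw [Set.mem_preimage, mem_closedBall_zero_iff]
  exact ContinuousLinearMap.opNorm_le_bound _ zero_le_one fun a =>
    (StateSpace.norm_apply_le ⟨φ, hφ⟩ a).trans_eq (one_mul _).symm

lemma norm_add_I_smul_one_sq_le [Nontrivial A] {a : A} (ha : IsSelfAdjoint a) (t : ℝ) :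
    ‖a + (t * Complex.I : ℂ) • (1 : A)‖ ^ 2 ≤ ‖a‖ ^ 2 + t ^ 2 := by
  have hmul : star (a + (t * Complex.I : ℂ) • (1 : A)) * (a + (t * Complex.I : ℂ) • (1 : A))
      = a * a + ((t ^ 2 : ℝ) : ℂ) • (1 : A) := by
    have hI : (t * Complex.I * (t * Complex.I) : ℂ) = -((t ^ 2 : ℝ) : ℂ) := by
      push_cast
      linear_combination (t : ℂ) ^ 2 * Complex.I_mul_I
    simp only [star_add, star_smul, star_one, ha.star_eq, star_mul', Complex.star_def,
      Complex.conj_ofReal, Complex.conj_I, mul_neg, neg_smul, add_mul, mul_add, neg_mul,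
      smul_mul_assoc, mul_smul_comm, one_mul, mul_one, smul_add, smul_neg, smul_smul,
      hI]
    abel
  calc _ = ‖a * a + ((t ^ 2 : ℝ) : ℂ) • (1 : A)‖ := by
        rw [sq, ← CStarRing.norm_star_mul_self, hmul]
    _ ≤ ‖a‖ * ‖a‖ + ‖((t ^ 2 : ℝ) : ℂ)‖ * ‖(1 : A)‖ :=
        (norm_add_le _ _).trans (add_le_add (norm_mul_le _ _) (norm_smul_le _ _))
    _ = ‖a‖ ^ 2 + t ^ 2 := by
        rw [norm_one, mul_one, Complex.norm_real, Real.norm_of_nonneg (sq_nonneg t), sq ‖a‖]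

lemma im_eq_zero_of_norm_apply_le {φ : A →ₗ[ℂ] ℂ} (hone : φ 1 = 1) (hφ : ∀ a, ‖φ a‖ ≤ ‖a‖)
    {a : A} (ha : IsSelfAdjoint a) : (φ a).im = 0 := by
  have : Nontrivial A := ⟨1, 0, fun h => one_ne_zero (hone.symm.trans (by rw [h, map_zero]))⟩
  have hlinear (t : ℝ) : 2 * (φ a).im * t ≤ ‖a‖ ^ 2 := by
    have hsq : ‖φ (a + (t * Complex.I : ℂ) • (1 : A))‖ ^ 2 ≤ ‖a‖ ^ 2 + t ^ 2 :=
      (pow_le_pow_left₀ (norm_nonneg _) (hφ _) 2).trans (norm_add_I_smul_one_sq_le ha t)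
    rw [map_add, map_smul, hone, Complex.sq_norm, Complex.normSq_apply] at hsq
    simp only [smul_eq_mul, mul_one, Complex.add_re, Complex.add_im, Complex.re_ofReal_mul,
      Complex.im_ofReal_mul, Complex.I_re, Complex.I_im, mul_zero, add_zero] at hsq
    nlinarith [sq_nonneg (φ a).re, sq_nonneg (φ a).im]
  by_contra hne
  have hlarge := hlinear ((‖a‖ ^ 2 + 1) / (2 * (φ a).im))
  rw [mul_div_cancel₀ _ (mul_ne_zero two_ne_zero hne)] at hlarge
  linarith

lemma isState_of_norm_apply_le {φ : WeakDual ℂ A} (hone : φ 1 = 1) (hφ : ∀ a, ‖φ a‖ ≤ ‖a‖) :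
    IsState φ := by
  refine ⟨hone, fun a => ?_⟩
  set x := star a * a
  have hx : IsSelfAdjoint x := IsSelfAdjoint.star_mul_self a
  have him : (φ x).im = 0 := im_eq_zero_of_norm_apply_le
    (φ := ((WeakDual.toStrongDual φ : A →L[ℂ] ℂ) : A →ₗ[ℂ] ℂ)) hone hφ hx
  have hnorm : ‖algebraMap ℝ A ‖x‖ - x‖ ≤ ‖x‖ :=
    (CStarAlgebra.norm_le_iff_le_algebraMap _ (norm_nonneg x)
      (sub_nonneg.2 hx.le_algebraMap_norm_self)).2 (sub_le_self _ (star_mul_self_nonneg a))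
  have hmap : φ (algebraMap ℝ A ‖x‖) = (‖x‖ : ℂ) := by
    rw [Algebra.algebraMap_eq_smul_one, ← Complex.coe_smul, map_smul, hone, smul_eq_mul, mul_one]
  have hre : ‖x‖ - (φ x).re ≤ ‖x‖ :=
    calc ‖x‖ - (φ x).re = (φ (algebraMap ℝ A ‖x‖ - x)).re := by
          rw [map_sub, hmap, Complex.sub_re, Complex.ofReal_re]
      _ ≤ ‖x‖ := (Complex.re_le_norm _).trans ((hφ _).trans hnorm)
  exact Complex.nonneg_iff.2 ⟨by linarith, him.symm⟩

theorem dualMap_surjective_of_injective {C : Type*} [CStarAlgebra C] {ρ : A →⋆ₐ[ℂ] C}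
    (hρ : Function.Injective ρ) : Function.Surjective (dualMap ρ) := by
  intro ω
  let e := LinearIsometry.equivRange
    (⟨(ρ : A →ₗ[ℂ] C), NonUnitalStarAlgHom.norm_map ρ hρ⟩ : A →ₗᵢ[ℂ] C)
  let f := (WeakDual.toStrongDual ω.1 : A →L[ℂ] ℂ).comp
    e.symm.toLinearIsometry.toContinuousLinearMap
  obtain ⟨g, hgf, hgnorm⟩ := exists_extension_norm_eq _ f
  have hgρ (a : A) : g (ρ a) = ω.1 a :=
    (hgf (e a)).trans (congrArg ω.1 (e.symm_apply_apply a))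
  have hf : ‖f‖ ≤ 1 := f.opNorm_le_bound zero_le_one fun x => by
    simpa [f] using ω.norm_apply_le (e.symm x)
  have hg (c : C) : ‖g c‖ ≤ ‖c‖ :=
    (g.le_opNorm c).trans (mul_le_of_le_one_left (norm_nonneg _) (hgnorm ▸ hf))
  have hone : g 1 = 1 := by rw [← map_one ρ, hgρ, ω.map_one]
  exact ⟨⟨StrongDual.toWeakDual g, isState_of_norm_apply_le hone hg⟩,
    Subtype.ext (DFunLike.ext _ _ hgρ)⟩

theorem exists_norm_state_apply_eq [Nontrivial A] {a : A} (ha : IsSelfAdjoint a) :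
    ∃ φ : StateSpace A, ‖φ.1 a‖ = ‖a‖ := by
  obtain ⟨z, hz, hz_norm⟩ := spectrum.exists_nnnorm_eq_spectralRadius a
  rw [ha.spectralRadius_eq_nnnorm, ENNReal.coe_inj] at hz_norm
  have : IsStarNormal a := ha.isStarNormal
  let S := StarAlgebra.elemental ℂ a
  have : IsClosed (S : Set A) := StarAlgebra.elemental.isClosed ℂ a
  let a' : S := ⟨a, StarAlgebra.elemental.self_mem ℂ a⟩
  obtain ⟨χ, hχ⟩ := WeakDual.CharacterSpace.mem_spectrum_iff_exists.1
    ((StarSubalgebra.mem_spectrum_iff S (a := a')).2 hz)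
  have hχ_norm (x : S) : ‖χ x‖ ≤ ‖x‖ := AlgHom.norm_apply_le_self χ x
  obtain ⟨φ, hφ⟩ := dualMap_surjective_of_injective (ρ := S.subtype) Subtype.val_injective
    ⟨(χ : WeakDual ℂ S), isState_of_norm_apply_le (map_one χ) hχ_norm⟩
  have hφa : φ.1 a = z := (congrArg (fun ψ : StateSpace S => ψ.1 a') hφ).trans hχ
  exact ⟨φ, hφa ▸ congrArg NNReal.toReal hz_norm⟩

instance [Nontrivial A] : Nonempty (StateSpace A) :=
  ⟨(exists_norm_state_apply_eq (IsSelfAdjoint.zero A)).choose⟩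

lemma norm_le_of_forall_norm_state_apply_le {a : A} (ha : IsSelfAdjoint a) {c : ℝ} (hc : 0 ≤ c)
    (h : ∀ φ : StateSpace A, ‖φ.1 a‖ ≤ c) : ‖a‖ ≤ c := by
  rcases subsingleton_or_nontrivial A with _ | _
  · rwa [Subsingleton.elim a 0, norm_zero]
  · obtain ⟨φ, hφ⟩ := exists_norm_state_apply_eq ha
    exact hφ ▸ h φ

end States

section Topology

variable {X : Type*} [t : TopologicalSpace X] [CompactSpace X] (m : PseudoEMetricSpace X)

lemma ediam_univ_lt_top_of_compactSpace (h : m.toUniformSpace.toTopologicalSpace = t)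
    (hfin : ∀ x y : X, edist x y < ∞) : @Metric.ediam X m Set.univ < ∞ := by
  subst h
  let m' := PseudoEMetricSpace.toPseudoMetricSpace fun x y : X => (hfin x y).ne
  exact (Metric.isBounded_iff_ediam_ne_top.1 (isCompact_univ (X := X)).isBounded).lt_top

lemma secondCountableTopology_of_compactSpace (h : m.toUniformSpace.toTopologicalSpace = t) :
    SecondCountableTopology X := by
  subst h
  exact EMetric.secondCountable_of_sigmaCompact X

lemma toTopologicalSpace_eq_of_compactSpace (hsep : ∀ x y : X, edist x y = 0 → x = y)
    (hnhds : ∀ x : X, ∀ ε : ℝ≥0∞, 0 < ε → ∀ᶠ y in nhds x, edist y x ≤ ε) :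
    m.toUniformSpace.toTopologicalSpace = t := by
  have hcont : @Continuous X X t m.toUniformSpace.toTopologicalSpace id := by
    refine @continuous_iff_continuousAt _ _ t m.toUniformSpace.toTopologicalSpace _ |>.2 fun x => ?_
    exact (Metric.nhds_basis_closedEBall (x := x)).tendsto_right_iff.2 (hnhds x)
  have hT2 : @T2Space X m.toUniformSpace.toTopologicalSpace := by
    let m' : EMetricSpace X := { m with eq_of_edist_eq_zero := fun {x y} h => hsep x y h }
    exact inferInstance
  have hquot := @Topology.IsQuotientMap.of_surjective_continuous X X t
    m.toUniformSpace.toTopologicalSpace _ hT2 id Function.surjective_id hcont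
  have hcoind := @Topology.IsQuotientMap.isCoinducing _ _ t m.toUniformSpace.toTopologicalSpace _
    hquot
  exact (@Topology.IsCoinducing.eq_coinduced _ _ t m.toUniformSpace.toTopologicalSpace _
    hcoind).trans coinduced_id

end Topology

section Metric

variable {A : Type*} [CStarAlgebra A] {L : PartialSeminorm A}
  {F : ℝ≥0 → ℝ≥0 → ℝ≥0 → ℝ≥0 → ℝ≥0}

lemma PartialSeminorm.apply_inv_smul_le_one {a : selfAdjoint A} {c : ℝ≥0} (hc : c ≠ 0)
    (ha : L a ≤ c) : L ((c : ℝ)⁻¹ • a) ≤ 1 := by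
  have hinv : ‖(c : ℝ)⁻¹‖ₑ = (c : ℝ≥0∞)⁻¹ := by
    rw [enorm_inv (NNReal.coe_ne_zero.2 hc), NNReal.enorm_eq]
  rw [L.smul', hinv, mul_comm, ← div_eq_mul_inv]
  exact ENNReal.div_le_of_le_mul (ha.trans_eq (one_mul _).symm)

lemma StateSpace.apply_real_smul (φ : StateSpace A) (r : ℝ) (a : A) :
    φ.1 (r • a) = r * φ.1 a := by
  rw [← Complex.coe_smul, map_smul, smul_eq_mul]

lemma StateSpace.coe_re_apply (φ : StateSpace A) (a : selfAdjoint A) :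
    (((φ.1 (a : A)).re : ℝ) : ℂ) = φ.1 (a : A) :=
  Complex.ext (Complex.ofReal_re _) (by rw [Complex.ofReal_im, φ.im_apply_eq_zero a.2])

lemma enorm_sub_le_mkDist {a : selfAdjoint A} (ha : L a ≤ 1) (φ ψ : StateSpace A) :
    ‖φ.1 (a : A) - ψ.1 (a : A)‖ₑ ≤ mkDist L φ ψ :=
  le_iSup₂ (f := fun (a : selfAdjoint A) (_ : L a ≤ 1) => ‖φ.1 (a : A) - ψ.1 (a : A)‖ₑ) a ha

lemma mkDist_le_iff {φ ψ : StateSpace A} {c : ℝ≥0∞} :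
    mkDist L φ ψ ≤ c ↔ ∀ a : selfAdjoint A, L a ≤ 1 → ‖φ.1 (a : A) - ψ.1 (a : A)‖ₑ ≤ c :=
  iSup₂_le_iff

lemma mkDist_le_stateDiam (φ ψ : StateSpace A) : mkDist L φ ψ ≤ stateDiam L :=
  @Metric.edist_le_ediam_of_mem _ _ _ _ (mkMetric L) (Set.mem_univ φ) (Set.mem_univ ψ)

lemma enorm_sub_le_mul_mkDist {a : selfAdjoint A} {c : ℝ≥0} (hc : c ≠ 0) (ha : L a ≤ c)
    (φ ψ : StateSpace A) : ‖φ.1 (a : A) - ψ.1 (a : A)‖ₑ ≤ c * mkDist L φ ψ := by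
  set b : selfAdjoint A := (c : ℝ)⁻¹ • a
  have hab : (a : A) = (c : ℝ) • (b : A) :=
    congrArg Subtype.val (smul_inv_smul₀ (NNReal.coe_ne_zero.2 hc) a).symm
  calc ‖φ.1 (a : A) - ψ.1 (a : A)‖ₑ = c * ‖φ.1 (b : A) - ψ.1 (b : A)‖ₑ := by
        rw [hab, φ.apply_real_smul, ψ.apply_real_smul, ← mul_sub, enorm_mul,
          ← ofReal_norm, Complex.norm_real, ofReal_norm, NNReal.enorm_eq]
    _ ≤ c * mkDist L φ ψ := by
        gcongr
        exact enorm_sub_le_mkDist (PartialSeminorm.apply_inv_smul_le_one hc ha) φ ψ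

lemma eq_of_mkDist_eq_zero (hdense : Dense (L.dom : Set (selfAdjoint A))) {φ ψ : StateSpace A}
    (h : mkDist L φ ψ = 0) : φ = ψ := by
  have hclosed : IsClosed {a : selfAdjoint A | φ.1 (a : A) = ψ.1 (a : A)} :=
    isClosed_eq ((WeakDual.toStrongDual φ.1).continuous.comp continuous_subtype_val)
      ((WeakDual.toStrongDual ψ.1).continuous.comp continuous_subtype_val)
  have hdom : (L.dom : Set (selfAdjoint A)) ⊆ {a | φ.1 (a : A) = ψ.1 (a : A)} := by
    intro a (ha : L a < ∞)
    have hle : L a ≤ ((L a).toNNReal + 1 : ℝ≥0) := by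
      rw [ENNReal.coe_add, ENNReal.coe_toNNReal ha.ne]
      exact le_self_add
    have hzero := enorm_sub_le_mul_mkDist (by positivity) hle φ ψ
    rw [h, mul_zero, nonpos_iff_eq_zero, enorm_eq_zero] at hzero
    exact sub_eq_zero.1 hzero
  exact StateSpace.ext_selfAdjoint fun a => hclosed.closure_subset_iff.2 hdom (hdense a)

namespace IsQuantumCompactMetricSpace

lemma apply_smul_one (hL : IsQuantumCompactMetricSpace F L) (r : ℝ) : L (r • 1) = 0 :=
  hL.ker.ge ⟨r, rfl⟩

lemma apply_one (hL : IsQuantumCompactMetricSpace F L) : L 1 = 0 := by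
  simpa only [one_smul] using hL.apply_smul_one 1

lemma stateDiam_lt_top (hL : IsQuantumCompactMetricSpace F L) : stateDiam L < ∞ :=
  ediam_univ_lt_top_of_compactSpace (mkMetric L) hL.mk_topology hL.mk_finite

lemma enorm_sub_le_mul_stateDiam (hL : IsQuantumCompactMetricSpace F L) {a : selfAdjoint A}
    (ha : L a < ∞) (φ ψ : StateSpace A) :
    ‖φ.1 (a : A) - ψ.1 (a : A)‖ₑ ≤ L a * stateDiam L := by
  rcases eq_or_ne (L a) 0 with hzero | hne
  · obtain ⟨r, rfl⟩ := hL.ker.le hzero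
    simp only [selfAdjoint.val_smul, selfAdjoint.val_one, StateSpace.apply_real_smul,
      StateSpace.map_one, sub_self, enorm_zero, zero_le]
  · have hc := ENNReal.coe_toNNReal ha.ne
    calc ‖φ.1 (a : A) - ψ.1 (a : A)‖ₑ ≤ (L a).toNNReal * mkDist L φ ψ :=
          enorm_sub_le_mul_mkDist (ENNReal.toNNReal_ne_zero.2 ⟨hne, ha.ne⟩) hc.ge φ ψ
      _ ≤ L a * stateDiam L := by
          rw [hc]
          gcongr
          exact mkDist_le_stateDiam φ ψ

lemma exists_enorm_sub_smul_one_le [Nontrivial A] (hL : IsQuantumCompactMetricSpace F L)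
    {a : selfAdjoint A} (ha : L a < ∞) :
    ∃ s : ℝ, ‖(a : A) - s • (1 : A)‖ₑ ≤ L a * stateDiam L := by
  obtain ⟨μ⟩ : Nonempty (StateSpace A) := inferInstance
  have hfin : L a * stateDiam L ≠ ∞ := (ENNReal.mul_lt_top ha hL.stateDiam_lt_top).ne
  set s : ℝ := (μ.1 (a : A)).re
  refine ⟨s, ?_⟩
  rw [← ofReal_norm, ENNReal.ofReal_le_iff_le_toReal hfin]
  refine norm_le_of_forall_norm_state_apply_le (a - s • (1 : selfAdjoint A)).2
    ENNReal.toReal_nonneg fun φ => ?_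
  have hφ : φ.1 (a - s • (1 : A)) = φ.1 (a : A) - μ.1 (a : A) := by
    rw [map_sub, φ.apply_real_smul, φ.map_one, mul_one, μ.coe_re_apply]
  rw [← toReal_enorm]
  exact ENNReal.toReal_mono hfin (hφ ▸ hL.enorm_sub_le_mul_stateDiam ha φ μ)

end IsQuantumCompactMetricSpace

/-- Kadison's function representation: self-adjoint elements as functions on the state space. -/
noncomputable def evalState (a : selfAdjoint A) : C(StateSpace A, ℂ) :=
  ⟨fun φ => φ.1 (a : A), StateSpace.continuous_eval _⟩

instance : CompleteSpace (selfAdjoint A) :=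
  (isClosed_eq continuous_star continuous_id).completeSpace_coe

lemma isometry_evalState : Isometry (evalState (A := A)) := by
  refine Isometry.of_dist_eq fun a b => ?_
  have hsub (φ : StateSpace A) : dist (evalState a φ) (evalState b φ) = ‖φ.1 (a - b : A)‖ :=
    (dist_eq_norm _ _).trans (congrArg norm (map_sub φ.1 (a : A) b).symm)
  have hab : dist a b = ‖(a - b : A)‖ := dist_eq_norm a b
  refine le_antisymm ((ContinuousMap.dist_le dist_nonneg).2 fun φ => ?_) ?_
  · rw [hsub, hab]
    exact φ.norm_apply_le _
  · rw [hab]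
    exact norm_le_of_forall_norm_state_apply_le (a - b).2 dist_nonneg fun φ =>
      (hsub φ).ge.trans (ContinuousMap.dist_apply_le_dist φ)

lemma separableSpace_of_secondCountableTopology_stateSpace
    [SecondCountableTopology (StateSpace A)] : TopologicalSpace.SeparableSpace A := by
  have : SecondCountableTopology (selfAdjoint A) :=
    isometry_evalState.isUniformInducing.isInducing.secondCountableTopology
  have hsurj : Function.Surjective fun p : selfAdjoint A × selfAdjoint A =>
      (p.1 : A) + Complex.I • (p.2 : A) :=
    fun a => ⟨(realPart a, imaginaryPart a), realPart_add_I_smul_imaginaryPart a⟩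
  exact hsurj.denseRange.separableSpace (by fun_prop)

lemma IsQuantumCompactMetricSpace.separableSpace (hL : IsQuantumCompactMetricSpace F L) :
    TopologicalSpace.SeparableSpace A := by
  have := secondCountableTopology_of_compactSpace (mkMetric L) hL.mk_topology
  exact separableSpace_of_secondCountableTopology_stateSpace

/-- The elements of the unit ball of `L` vanishing at the state `μ`. By Rieffel's criterion, `L`
metrizes the weak* topology of the state space when this set is compact. -/
def lipBall (L : PartialSeminorm A) (μ : StateSpace A) : Set (selfAdjoint A) :=
  {a | L a ≤ 1 ∧ μ.1 (a : A) = 0}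

theorem IsQuantumCompactMetricSpace.isCompact_lipBall (hL : IsQuantumCompactMetricSpace F L)
    (μ : StateSpace A) : IsCompact (lipBall L μ) := by
  let T : selfAdjoint A → BoundedContinuousFunction (StateSpace A) ℂ :=
    ContinuousMap.isometryEquivBoundedOfCompact _ _ ∘ evalState
  have hT : Isometry T := (IsometryEquiv.isometry _).comp isometry_evalState
  have hclosed : IsClosed (lipBall L μ) := hL.closed.inter
    (isClosed_eq ((WeakDual.toStrongDual μ.1).continuous.comp continuous_subtype_val)
      continuous_const)
  rw [hT.isEmbedding.isCompact_iff]
  refine BoundedContinuousFunction.arzela_ascoli₂ _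
    (isCompact_closedBall (0 : ℂ) (stateDiam L).toReal) _
    (hT.isClosedEmbedding.isClosedMap _ hclosed) ?_ fun φ => ?_
  · rintro _ φ ⟨a, ha, rfl⟩
    have hφ := (enorm_sub_le_mkDist ha.1 φ μ).trans (mkDist_le_stateDiam φ μ)
    rw [ha.2, sub_zero] at hφ
    rw [mem_closedBall_zero_iff, ← toReal_enorm]
    exact ENNReal.toReal_mono hL.stateDiam_lt_top.ne hφ
  · rw [Metric.equicontinuousAt_iff_right]
    intro ε hε
    have hball : ∀ᶠ ψ in nhds φ, mkDist L ψ φ < ENNReal.ofReal ε := by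
      have h := @Metric.eball_mem_nhds _ (mkMetric L) φ _ (ENNReal.ofReal_pos.2 hε)
      rwa [hL.mk_topology] at h
    filter_upwards [hball] with ψ hψ
    rintro ⟨_, a, ha, rfl⟩
    have hlt := (enorm_sub_le_mkDist ha.1 ψ φ).trans_lt hψ
    rw [← ofReal_norm, ENNReal.ofReal_lt_ofReal_iff hε] at hlt
    rwa [dist_comm, dist_eq_norm]

lemma exists_mem_lipBall_add_smul_one (hone : L 1 = 0) (μ : StateSpace A) {a : selfAdjoint A}
    (ha : L a ≤ 1) : ∃ a₀ ∈ lipBall L μ, ∃ s : ℝ, a = a₀ + s • 1 := by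
  set s : ℝ := (μ.1 (a : A)).re
  refine ⟨a - s • 1, ⟨?_, ?_⟩, s, (sub_add_cancel _ _).symm⟩
  · have hadd := L.add_le' a ((-s) • 1)
    rw [L.smul', hone, mul_zero, add_zero, neg_smul, ← sub_eq_add_neg] at hadd
    exact hadd.trans ha
  · change μ.1 (a - s • (1 : A)) = 0
    rw [map_sub, μ.apply_real_smul, μ.map_one, mul_one, μ.coe_re_apply, sub_self]

lemma mkDist_le_iff_lipBall (hone : L 1 = 0) (μ : StateSpace A) {φ ψ : StateSpace A} {c : ℝ≥0∞} :
    mkDist L φ ψ ≤ c ↔ ∀ a ∈ lipBall L μ, ‖φ.1 (a : A) - ψ.1 (a : A)‖ₑ ≤ c := by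
  refine mkDist_le_iff.trans ⟨fun h a ha => h a ha.1, fun h a ha => ?_⟩
  obtain ⟨a₀, ha₀, s, rfl⟩ := exists_mem_lipBall_add_smul_one hone μ ha
  have hshift (θ : StateSpace A) : θ.1 ((a₀ + s • 1 : selfAdjoint A) : A) = θ.1 (a₀ : A) + s := by
    change θ.1 (a₀ + s • (1 : A)) = _
    rw [map_add, θ.apply_real_smul, θ.map_one, mul_one]
  rw [hshift, hshift, add_sub_add_right_eq_sub]
  exact h a₀ ha₀

lemma mkDist_lt_top_of_isCompact_lipBall (hone : L 1 = 0) {μ : StateSpace A}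
    (hK : IsCompact (lipBall L μ)) (φ ψ : StateSpace A) : mkDist L φ ψ < ∞ := by
  obtain ⟨R, hR⟩ := hK.isBounded.exists_norm_le
  refine ((mkDist_le_iff_lipBall hone μ (c := ENNReal.ofReal (R + R))).2 fun a ha => ?_).trans_lt
    ENNReal.ofReal_lt_top
  rw [← ofReal_norm]
  exact ENNReal.ofReal_le_ofReal ((norm_sub_le _ _).trans
    (add_le_add ((φ.norm_apply_le _).trans (hR a ha)) ((ψ.norm_apply_le _).trans (hR a ha))))

lemma tendstoUniformlyOn_state_apply {K : Set (selfAdjoint A)} (hK : IsCompact K)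
    (φ : StateSpace A) :
    TendstoUniformlyOn (fun (ψ : StateSpace A) (a : selfAdjoint A) => ψ.1 (a : A))
      (fun a => φ.1 (a : A)) (nhds φ) K := by
  have := isCompact_iff_compactSpace.1 hK
  have hequi : Equicontinuous fun (ψ : StateSpace A) (a : K) => ψ.1 (a : A) := by
    refine (Metric.uniformEquicontinuous_of_continuity_modulus id Filter.tendsto_id _
      fun a b ψ => ?_).equicontinuous
    rw [dist_eq_norm, ← map_sub]
    exact (ψ.norm_apply_le _).trans_eq (dist_eq_norm (a : selfAdjoint A) b).symm
  rw [tendstoUniformlyOn_iff_tendstoUniformly_comp_coe]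
  exact UniformFun.tendsto_iff_tendstoUniformly.1 ((hequi.tendsto_uniformFun_iff_pi _ _).2
    (tendsto_pi_nhds.2 fun a => (StateSpace.continuous_eval _).tendsto φ))

theorem mk_topology_of_isCompact_lipBall (hdense : Dense (L.dom : Set (selfAdjoint A)))
    (hone : L 1 = 0) {μ : StateSpace A} (hK : IsCompact (lipBall L μ)) :
    (mkMetric L).toUniformSpace.toTopologicalSpace =
      (inferInstance : TopologicalSpace (StateSpace A)) := by
  refine toTopologicalSpace_eq_of_compactSpace (mkMetric L)
    (fun φ ψ => eq_of_mkDist_eq_zero hdense) fun φ ε hε => ?_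
  filter_upwards [EMetric.tendstoUniformlyOn_iff.1 (tendstoUniformlyOn_state_apply hK φ) ε hε]
    with ψ hψ
  refine (mkDist_le_iff_lipBall hone μ).2 fun a ha => ?_
  rw [← edist_eq_enorm_sub, edist_comm]
  exact (hψ a ha).le

end Metric

open scoped CStarAlgebra

section StarAlgHom

variable {E C : Type*} [CStarAlgebra E] [CStarAlgebra C]

lemma enorm_starAlgHom_apply_le (π : E →⋆ₐ[ℂ] C) (x : E) : ‖π x‖ₑ ≤ ‖x‖ₑ :=
  enorm_le_iff_norm_le.2 (NonUnitalStarAlgHom.norm_apply_le π x)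

lemma continuous_saMap (π : E →⋆ₐ[ℂ] C) : Continuous (saMap π) :=
  Continuous.subtype_mk (by fun_prop) _

lemma starAlgHom_real_smul_one (π : E →⋆ₐ[ℂ] C) (s : ℝ) : π (s • 1) = s • 1 := by
  rw [← Complex.coe_smul, map_smul, map_one, Complex.coe_smul]

variable (α β : E →⋆ₐ[ℂ] C)

lemma norm_map_mul_sub_map_mul_le (x y : E) :
    ‖α (x * y) - β (x * y)‖ ≤ ‖x‖ * ‖α y - β y‖ + ‖y‖ * ‖α x - β x‖ := by
  calc ‖α (x * y) - β (x * y)‖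
      = ‖α x * (α y - β y) + (α x - β x) * β y‖ := by
        rw [map_mul, map_mul]
        noncomm_ring
    _ ≤ ‖α x‖ * ‖α y - β y‖ + ‖α x - β x‖ * ‖β y‖ :=
        (norm_add_le _ _).trans (add_le_add (norm_mul_le _ _) (norm_mul_le _ _))
    _ ≤ ‖x‖ * ‖α y - β y‖ + ‖y‖ * ‖α x - β x‖ := by
        rw [mul_comm ‖y‖]
        gcongr
        exacts [NonUnitalStarAlgHom.norm_apply_le α x, NonUnitalStarAlgHom.norm_apply_le β y]

lemma norm_map_jordanProd_sub_map_jordanProd_le (x y : selfAdjoint E) :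
    ‖α (jordanProd x y) - β (jordanProd x y)‖ ≤
      ‖(x : E)‖ * ‖α y - β y‖ + ‖(y : E)‖ * ‖α x - β x‖ := by
  have hsplit : α (jordanProd x y) - β (jordanProd x y) = (1 / 2 : ℂ) •
      ((α (x * y : E) - β (x * y : E)) + (α (y * x : E) - β (y * x : E))) := by
    simp only [jordanProd, map_smul, map_add, ← smul_sub, add_sub_add_comm]
  have hc : ‖(1 / 2 : ℂ)‖ = 1 / 2 := by simp
  rw [hsplit, norm_smul, hc]
  linarith [norm_add_le (α (x * y : E) - β (x * y : E)) (α (y * x : E) - β (y * x : E)),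
    norm_map_mul_sub_map_mul_le α β (x : E) y, norm_map_mul_sub_map_mul_le α β (y : E) x]

lemma norm_map_lieProd_sub_map_lieProd_le (x y : selfAdjoint E) :
    ‖α (lieProd x y) - β (lieProd x y)‖ ≤
      ‖(x : E)‖ * ‖α y - β y‖ + ‖(y : E)‖ * ‖α x - β x‖ := by
  have hsplit : α (lieProd x y) - β (lieProd x y) = (1 / (2 * Complex.I) : ℂ) •
      ((α (x * y : E) - β (x * y : E)) - (α (y * x : E) - β (y * x : E))) := by
    simp only [lieProd, map_smul, map_sub, ← smul_sub, sub_sub_sub_comm]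
  have hc : ‖(1 / (2 * Complex.I) : ℂ)‖ = 1 / 2 := by simp
  rw [hsplit, norm_smul, hc]
  linarith [norm_sub_le (α (x * y : E) - β (x * y : E)) (α (y * x : E) - β (y * x : E)),
    norm_map_mul_sub_map_mul_le α β (x : E) y, norm_map_mul_sub_map_mul_le α β (y : E) x]

variable {α β} {L : PartialSeminorm E} {r : ℝ≥0∞}

lemma StateSpace.enorm_apply_le (φ : StateSpace E) (x : E) : ‖φ.1 x‖ₑ ≤ ‖x‖ₑ :=
  enorm_le_iff_norm_le.2 (φ.norm_apply_le x)

lemma mkDist_dualMap_le (h : ∀ x : selfAdjoint E, L x ≤ 1 → ‖α x - β x‖ₑ ≤ r)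
    (Ω : StateSpace C) : mkDist L (dualMap α Ω) (dualMap β Ω) ≤ r := by
  refine mkDist_le_iff.2 fun x hx => le_trans ?_ (h x hx)
  have hsub : Ω.1 (α x) - Ω.1 (β x) = Ω.1 (α x - β x) := (map_sub Ω.1 _ _).symm
  exact (congrArg enorm hsub).trans_le (Ω.enorm_apply_le _)

lemma mkHausdorff_univ_range_dualMap_le (h : ∀ ω, ∃ φ, mkDist L ω (dualMap α φ) ≤ r) :
    mkHausdorff L Set.univ (Set.range (dualMap α)) ≤ r := by
  refine @Metric.hausdorffEDist_le_of_mem_edist _ (mkMetric L) _ _ _ (fun ω _ => ?_)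
    fun φ _ => ⟨φ, Set.mem_univ φ, (@edist_self _ (mkMetric L) φ).trans_le zero_le⟩
  obtain ⟨φ, hφ⟩ := h ω
  exact ⟨_, ⟨φ, rfl⟩, hφ⟩

end StarAlgHom

section Glue

variable {A B : Type*} [CStarAlgebra A] [CStarAlgebra B]

/-- The self-adjoint element of a product algebra with the given components. -/
def saPair (a : selfAdjoint A) (b : selfAdjoint B) : selfAdjoint (A × B) :=
  ⟨(a, b), Prod.ext a.2 b.2⟩

lemma continuous_saPair :
    Continuous fun p : selfAdjoint A × selfAdjoint B => saPair p.1 p.2 := by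
  unfold saPair
  fun_prop

lemma surjective_saPair :
    Function.Surjective fun p : selfAdjoint A × selfAdjoint B => saPair p.1 p.2 :=
  fun x => ⟨(saMap (StarAlgHom.fst ℂ A B) x, saMap (StarAlgHom.snd ℂ A B) x), rfl⟩

variable {H : Type*} [NormedAddCommGroup H] [InnerProductSpace ℂ H] [CompleteSpace H]
  {LA : PartialSeminorm A} {LB : PartialSeminorm B}
  {πA : A →⋆ₐ[ℂ] (H →L[ℂ] H)} {πB : B →⋆ₐ[ℂ] (H →L[ℂ] H)} {r : ℝ≥0∞}
  {F : ℝ≥0 → ℝ≥0 → ℝ≥0 → ℝ≥0 → ℝ≥0}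

lemma glue_le_iff {x : selfAdjoint (A × B)} {c : ℝ≥0∞} :
    glue LA LB πA πB r x ≤ c ↔ LA (saMap (StarAlgHom.fst ℂ A B) x) ≤ c ∧
      LB (saMap (StarAlgHom.snd ℂ A B) x) ≤ c ∧
      ‖πA (x : A × B).1 - πB (x : A × B).2‖ₑ / r ≤ c := by
  simp only [glue, max_le_iff, and_assoc]

lemma glue_lt_top_iff (hr : r ≠ 0) {x : selfAdjoint (A × B)} :
    glue LA LB πA πB r x < ∞ ↔ LA (saMap (StarAlgHom.fst ℂ A B) x) < ∞ ∧
      LB (saMap (StarAlgHom.snd ℂ A B) x) < ∞ := by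
  simp only [glue, max_lt_iff]
  exact and_iff_left (ENNReal.div_lt_top enorm_ne_top hr)

lemma dense_dom_glue (hA : Dense (LA.dom : Set (selfAdjoint A)))
    (hB : Dense (LB.dom : Set (selfAdjoint B))) (hr : r ≠ 0) :
    Dense ((glue LA LB πA πB r).dom : Set (selfAdjoint (A × B))) := by
  refine (surjective_saPair.denseRange.dense_image continuous_saPair (hA.prod hB)).mono ?_
  rintro _ ⟨p, hp, rfl⟩
  exact (glue_lt_top_iff hr).2 hp

lemma isClosed_glue_le_one (hA : IsClosed {a | LA a ≤ 1}) (hB : IsClosed {b | LB b ≤ 1})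
    (hr : r ≠ 0) (hr' : r ≠ ∞) : IsClosed {x | glue LA LB πA πB r x ≤ 1} := by
  simp only [glue_le_iff, ENNReal.div_le_iff hr hr', Set.ofPred_and]
  refine (hA.preimage (continuous_saMap _)).inter ((hB.preimage (continuous_saMap _)).inter
    (isClosed_le ?_ continuous_const))
  exact Continuous.enorm (by fun_prop)

lemma glue_le_of_norm_sub_le (hF : IsPermissible F) {x y z : selfAdjoint (A × B)}
    (hx : x ∈ (glue LA LB πA πB r).dom) (hy : y ∈ (glue LA LB πA πB r).dom)
    (hA : LA (saMap (StarAlgHom.fst ℂ A B) z) ≤ F ‖(x : A × B).1‖₊ ‖(y : A × B).1‖₊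
      (LA (saMap (StarAlgHom.fst ℂ A B) x)).toNNReal
      (LA (saMap (StarAlgHom.fst ℂ A B) y)).toNNReal)
    (hB : LB (saMap (StarAlgHom.snd ℂ A B) z) ≤ F ‖(x : A × B).2‖₊ ‖(y : A × B).2‖₊
      (LB (saMap (StarAlgHom.snd ℂ A B) x)).toNNReal
      (LB (saMap (StarAlgHom.snd ℂ A B) y)).toNNReal)
    (hz : ‖πA (z : A × B).1 - πB (z : A × B).2‖ ≤
      ‖(x : A × B)‖ * ‖πA (y : A × B).1 - πB (y : A × B).2‖ +
        ‖(y : A × B)‖ * ‖πA (x : A × B).1 - πB (x : A × B).2‖) :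
    glue LA LB πA πB r z ≤ F ‖(x : A × B)‖₊ ‖(y : A × B)‖₊
      (glue LA LB πA πB r x).toNNReal (glue LA LB πA πB r y).toNNReal := by
  have hxt : glue LA LB πA πB r x ≠ ∞ := LT.lt.ne hx
  have hyt : glue LA LB πA πB r y ≠ ∞ := LT.lt.ne hy
  obtain ⟨hxA, hxB, hxr⟩ := glue_le_iff.1 (le_refl (glue LA LB πA πB r x))
  obtain ⟨hyA, hyB, hyr⟩ := glue_le_iff.1 (le_refl (glue LA LB πA πB r y))
  refine glue_le_iff.2 ⟨hA.trans (ENNReal.coe_le_coe.2 ?_), hB.trans (ENNReal.coe_le_coe.2 ?_), ?_⟩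
  · exact hF.mono _ _ _ _ _ _ _ _ (norm_fst_le (x : A × B)) (norm_fst_le (y : A × B))
      (ENNReal.toNNReal_mono hxt hxA) (ENNReal.toNNReal_mono hyt hyA)
  · exact hF.mono _ _ _ _ _ _ _ _ (norm_snd_le (x : A × B)) (norm_snd_le (y : A × B))
      (ENNReal.toNNReal_mono hxt hxB) (ENNReal.toNNReal_mono hyt hyB)
  · calc ‖πA (z : A × B).1 - πB (z : A × B).2‖ₑ / r
        ≤ (‖(x : A × B)‖ₑ * ‖πA (y : A × B).1 - πB (y : A × B).2‖ₑ +
          ‖(y : A × B)‖ₑ * ‖πA (x : A × B).1 - πB (x : A × B).2‖ₑ) / r :=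
          ENNReal.div_le_div_right (ENNReal.coe_le_coe.2 hz) r
      _ ≤ ‖(x : A × B)‖ₑ * glue LA LB πA πB r y + ‖(y : A × B)‖ₑ * glue LA LB πA πB r x := by
          rw [ENNReal.add_div, mul_div_assoc, mul_div_assoc]
          gcongr
      _ ≤ _ := by
          conv_lhs => rw [← ENNReal.coe_toNNReal hxt, ← ENNReal.coe_toNNReal hyt]
          exact ENNReal.coe_le_coe.2 (hF.le _ _ _ _)

lemma isQuasiLeibniz_glue (hF : IsPermissible F) (hA : IsQuasiLeibniz F LA)
    (hB : IsQuasiLeibniz F LB) : IsQuasiLeibniz F (glue LA LB πA πB r) := by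
  intro x hx y hy
  obtain ⟨hxA, hxB, -⟩ := glue_le_iff.1 (le_refl (glue LA LB πA πB r x))
  obtain ⟨hyA, hyB, -⟩ := glue_le_iff.1 (le_refl (glue LA LB πA πB r y))
  obtain ⟨hjA, hlA⟩ := hA _ (hxA.trans_lt hx) _ (hyA.trans_lt hy)
  obtain ⟨hjB, hlB⟩ := hB _ (hxB.trans_lt hx) _ (hyB.trans_lt hy)
  let α := πA.comp (StarAlgHom.fst ℂ A B)
  let β := πB.comp (StarAlgHom.snd ℂ A B)
  have hj := norm_map_jordanProd_sub_map_jordanProd_le α β x y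
  have hl := norm_map_lieProd_sub_map_lieProd_le α β x y
  exact ⟨glue_le_of_norm_sub_le hF hx hy hjA hjB hj, glue_le_of_norm_sub_le hF hx hy hlA hlB hl⟩

lemma setOf_glue_eq_zero [Nontrivial H] (hA : {a | LA a = 0} = Set.range fun s : ℝ => s • 1)
    (hB : {b | LB b = 0} = Set.range fun s : ℝ => s • 1) (hr' : r ≠ ∞) :
    {x | glue LA LB πA πB r x = 0} = Set.range fun s : ℝ => s • 1 := by
  ext x
  rw [Set.mem_ofPred_eq, ← nonpos_iff_eq_zero, glue_le_iff]
  simp only [nonpos_iff_eq_zero]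
  constructor
  · rintro ⟨hxA, hxB, hxr⟩
    obtain ⟨s, hs⟩ := hA.le hxA
    obtain ⟨t, ht⟩ := hB.le hxB
    have hs' : (x : A × B).1 = s • (1 : A) := (congrArg Subtype.val hs).symm
    have ht' : (x : A × B).2 = t • (1 : B) := (congrArg Subtype.val ht).symm
    have hst : s • (1 : H →L[ℂ] H) = t • 1 := by
      rw [ENNReal.div_eq_zero_iff, or_iff_left hr', enorm_eq_zero, sub_eq_zero, hs', ht',
        starAlgHom_real_smul_one, starAlgHom_real_smul_one] at hxr
      exact hxr
    refine ⟨s, Subtype.ext (Prod.ext hs'.symm ?_)⟩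
    rw [ht', ← smul_left_injective ℝ one_ne_zero hst]
    rfl
  · rintro ⟨s, rfl⟩
    refine ⟨hA.ge ⟨s, rfl⟩, hB.ge ⟨s, rfl⟩, ?_⟩
    change ‖πA (s • (1 : A)) - πB (s • (1 : B))‖ₑ / r = 0
    rw [starAlgHom_real_smul_one, starAlgHom_real_smul_one, sub_self, enorm_zero, ENNReal.zero_div]

lemma isCompact_lipBall_glue [Nontrivial H] (hB1 : LB 1 = 0) {μ : StateSpace A} {ν : StateSpace B}
    (hA : IsCompact (lipBall LA μ)) (hB : IsCompact (lipBall LB ν)) (hr : r ≠ 0) (hr' : r ≠ ∞)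
    (hclosed : IsClosed {x | glue LA LB πA πB r x ≤ 1}) :
    IsCompact (lipBall (glue LA LB πA πB r) (dualMap (StarAlgHom.fst ℂ A B) μ)) := by
  obtain ⟨RA, hRA⟩ := hA.isBounded.exists_norm_le
  obtain ⟨RB, hRB⟩ := hB.isBounded.exists_norm_le
  have hshift : Continuous fun p : selfAdjoint A × selfAdjoint B × ℝ =>
      saPair p.1 (p.2.1 + p.2.2 • 1) :=
    continuous_saPair.comp (continuous_fst.prodMk (by fun_prop :
      Continuous fun p : selfAdjoint A × selfAdjoint B × ℝ => p.2.1 + p.2.2 • (1 : selfAdjoint B)))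
  refine ((hA.prod (hB.prod (isCompact_closedBall (0 : ℝ) (RA + r.toReal + RB)))).image
    hshift).of_isClosed_subset (hclosed.inter (isClosed_eq
      ((WeakDual.toStrongDual (dualMap _ μ).1).continuous.comp continuous_subtype_val)
      continuous_const)) ?_
  rintro x ⟨hx, hμ⟩
  obtain ⟨hxA, hxB, hxr⟩ := glue_le_iff.1 hx
  set a := saMap (StarAlgHom.fst ℂ A B) x
  set b := saMap (StarAlgHom.snd ℂ A B) x
  have haK : a ∈ lipBall LA μ := ⟨hxA, hμ⟩
  obtain ⟨b₀, hb₀, t, hbt⟩ := exists_mem_lipBall_add_smul_one hB1 ν hxB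
  refine ⟨(a, b₀, t), ⟨haK, hb₀, ?_⟩, congrArg (saPair a) hbt.symm⟩
  have hab : ‖πA (a : A) - πB (b : B)‖ ≤ r.toReal := by
    rw [ENNReal.div_le_iff hr hr', one_mul] at hxr
    exact (toReal_enorm _).ge.trans (ENNReal.toReal_mono hr' hxr)
  have hπb : πB (b : B) = πB (b₀ : B) + t • 1 := by
    rw [hbt]
    exact (map_add πB _ _).trans (congrArg _ (starAlgHom_real_smul_one πB t))
  have ht : t • (1 : H →L[ℂ] H) = πA (a : A) - (πA (a : A) - πB (b : B)) - πB (b₀ : B) := by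
    rw [hπb]
    abel
  calc dist t 0 = ‖t • (1 : H →L[ℂ] H)‖ := by rw [norm_smul, norm_one, mul_one, dist_zero_right]
    _ ≤ ‖πA (a : A)‖ + ‖πA (a : A) - πB (b : B)‖ + ‖πB (b₀ : B)‖ := by
        rw [ht]
        exact (norm_sub_le _ _).trans (by gcongr; exact norm_sub_le _ _)
    _ ≤ RA + r.toReal + RB := by
        gcongr
        · exact (NonUnitalStarAlgHom.norm_apply_le πA _).trans (hRA a haK)
        · exact (NonUnitalStarAlgHom.norm_apply_le πB _).trans (hRB b₀ hb₀)

theorem isQuantumCompactMetricSpace_glue [Nontrivial H] (hF : IsPermissible F)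
    (hA : IsQuantumCompactMetricSpace F LA) (hB : IsQuantumCompactMetricSpace F LB)
    (hr : r ≠ 0) (hr' : r ≠ ∞) : IsQuantumCompactMetricSpace F (glue LA LB πA πB r) := by
  have : Nontrivial A := (πA : A →+* (H →L[ℂ] H)).domain_nontrivial
  have : Nontrivial B := (πB : B →+* (H →L[ℂ] H)).domain_nontrivial
  obtain ⟨μ⟩ : Nonempty (StateSpace A) := inferInstance
  obtain ⟨ν⟩ : Nonempty (StateSpace B) := inferInstance
  have hdense := dense_dom_glue (πA := πA) (πB := πB) hA.dense_dom hB.dense_dom hr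
  have hker := setOf_glue_eq_zero (πA := πA) (πB := πB) hA.ker hB.ker hr'
  have hone : glue LA LB πA πB r 1 = 0 := hker.ge ⟨1, one_smul _ _⟩
  have hclosed := isClosed_glue_le_one (πA := πA) (πB := πB) hA.closed hB.closed hr hr'
  have hcompact := isCompact_lipBall_glue hB.apply_one (hA.isCompact_lipBall μ)
    (hB.isCompact_lipBall ν) hr hr' hclosed
  have hLeibniz := isQuasiLeibniz_glue (πA := πA) (πB := πB) (r := r) hF hA.quasiLeibniz
    hB.quasiLeibniz
  exact
    { dense_dom := hdense
      jordan_mem := fun x hx y hy => (hLeibniz x hx y hy).1.trans_lt ENNReal.coe_lt_top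
      lie_mem := fun x hx y hy => (hLeibniz x hx y hy).2.trans_lt ENNReal.coe_lt_top
      ker := hker
      closed := hclosed
      mk_finite := mkDist_lt_top_of_isCompact_lipBall hone hcompact
      mk_topology := mk_topology_of_isCompact_lipBall hdense hone hcompact
      quasiLeibniz := hLeibniz }

lemma enorm_map_sub_map_real_smul_one_le (πA : A →⋆ₐ[ℂ] (H →L[ℂ] H)) (πB : B →⋆ₐ[ℂ] (H →L[ℂ] H))
    (a : A) (s : ℝ) : ‖πA a - πB (s • 1)‖ₑ ≤ ‖a - s • 1‖ₑ := by
  rw [starAlgHom_real_smul_one, ← starAlgHom_real_smul_one πA, ← map_sub]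
  exact enorm_starAlgHom_apply_le πA _

lemma eq_iInf_glue_fst (hB : ∀ s : ℝ, LB (s • 1) = 0)
    (hA : ∀ a : selfAdjoint A, LA a < ∞ → ∃ s : ℝ, ‖(a : A) - s • 1‖ₑ ≤ LA a * r)
    (a : selfAdjoint A) : LA a = ⨅ (x) (_ : saMap (StarAlgHom.fst ℂ A B) x = a),
      glue LA LB πA πB r x := by
  refine le_antisymm (le_iInf₂ fun x hx => hx ▸ (glue_le_iff.1 le_rfl).1) ?_
  rcases eq_top_or_lt_top (LA a) with htop | hfin
  · exact htop ▸ le_top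
  obtain ⟨s, hs⟩ := hA a hfin
  refine iInf₂_le_of_le (saPair a (s • 1)) rfl (glue_le_iff.2 ⟨le_rfl, (hB s).trans_le zero_le, ?_⟩)
  exact ENNReal.div_le_of_le_mul ((enorm_map_sub_map_real_smul_one_le πA πB a s).trans hs)

lemma eq_iInf_glue_snd (hA : ∀ s : ℝ, LA (s • 1) = 0)
    (hB : ∀ b : selfAdjoint B, LB b < ∞ → ∃ s : ℝ, ‖(b : B) - s • 1‖ₑ ≤ LB b * r)
    (b : selfAdjoint B) : LB b = ⨅ (x) (_ : saMap (StarAlgHom.snd ℂ A B) x = b),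
      glue LA LB πA πB r x := by
  refine le_antisymm (le_iInf₂ fun x hx => hx ▸ (glue_le_iff.1 le_rfl).2.1) ?_
  rcases eq_top_or_lt_top (LB b) with htop | hfin
  · exact htop ▸ le_top
  obtain ⟨s, hs⟩ := hB b hfin
  refine iInf₂_le_of_le (saPair (s • 1) b) rfl (glue_le_iff.2 ⟨(hA s).trans_le zero_le, le_rfl, ?_⟩)
  refine ENNReal.div_le_of_le_mul (le_trans ?_ hs)
  exact (enorm_sub_rev _ _).trans_le (enorm_map_sub_map_real_smul_one_le πB πA b s)

theorem isTunnel_glue [Nontrivial H] (hF : IsPermissible F)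
    (hA : IsQuantumCompactMetricSpace F LA) (hB : IsQuantumCompactMetricSpace F LB)
    (hr : r ≠ 0) (hr' : r ≠ ∞) (hrA : stateDiam LA ≤ r) (hrB : stateDiam LB ≤ r) :
    IsTunnel F LA LB (glue LA LB πA πB r) (StarAlgHom.fst ℂ A B) (StarAlgHom.snd ℂ A B) := by
  have : Nontrivial A := (πA : A →+* (H →L[ℂ] H)).domain_nontrivial
  have : Nontrivial B := (πB : B →+* (H →L[ℂ] H)).domain_nontrivial
  refine ⟨isQuantumCompactMetricSpace_glue hF hA hB hr hr', Prod.fst_surjective,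
    Prod.snd_surjective, eq_iInf_glue_fst hB.apply_smul_one fun a ha => ?_,
    eq_iInf_glue_snd hA.apply_smul_one fun b hb => ?_⟩
  · obtain ⟨s, hs⟩ := hA.exists_enorm_sub_smul_one_le ha
    exact ⟨s, hs.trans (by gcongr)⟩
  · obtain ⟨s, hs⟩ := hB.exists_enorm_sub_smul_one_le hb
    exact ⟨s, hs.trans (by gcongr)⟩

theorem extent_glue_le (hπA : Function.Injective πA) (hπB : Function.Injective πB)
    (hr : r ≠ 0) (hr' : r ≠ ∞) :
    extent (glue LA LB πA πB r) (StarAlgHom.fst ℂ A B) (StarAlgHom.snd ℂ A B) ≤ r := by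
  let ρ : A × B →⋆ₐ[ℂ] (H →L[ℂ] H) × (H →L[ℂ] H) :=
    (πA.comp (StarAlgHom.fst ℂ A B)).prod (πB.comp (StarAlgHom.snd ℂ A B))
  have hρ : Function.Injective ρ := fun x y hxy =>
    Prod.ext (hπA (congrArg Prod.fst hxy)) (hπB (congrArg Prod.snd hxy))
  have hdist (x : selfAdjoint (A × B)) (hx : glue LA LB πA πB r x ≤ 1) :
      ‖πA (x : A × B).1 - πB (x : A × B).2‖ₑ ≤ r := by
    simpa only [ENNReal.div_le_iff hr hr', one_mul] using (glue_le_iff.1 hx).2.2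
  refine max_le (mkHausdorff_univ_range_dualMap_le fun ω => ?_)
    (mkHausdorff_univ_range_dualMap_le fun ω => ?_)
  all_goals obtain ⟨Ω, rfl⟩ := dualMap_surjective_of_injective hρ ω
  · refine ⟨dualMap (πA.prod πA) Ω, mkDist_dualMap_le
      (β := (πA.prod πA).comp (StarAlgHom.fst ℂ A B)) (fun x hx => ?_) Ω⟩
    rw [← edist_eq_enorm_sub]
    refine max_le ((edist_self _).trans_le zero_le) ?_
    exact (edist_eq_enorm_sub _ _).trans_le ((enorm_sub_rev _ _).trans_le (hdist x hx))
  · refine ⟨dualMap (πB.prod πB) Ω, mkDist_dualMap_le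
      (β := (πB.prod πB).comp (StarAlgHom.snd ℂ A B)) (fun x hx => ?_) Ω⟩
    rw [← edist_eq_enorm_sub]
    refine max_le ?_ ((edist_self _).trans_le zero_le)
    exact (edist_eq_enorm_sub _ _).trans_le (hdist x hx)

end Glue

section HilbertSpace

variable {𝕜 : Type*} [RCLike 𝕜]

lemma countable_of_orthonormal {ι H : Type*} [NormedAddCommGroup H] [InnerProductSpace 𝕜 H]
    [TopologicalSpace.SeparableSpace H] {e : ι → H} (he : Orthonormal 𝕜 e) : Countable ι := by
  refine Pairwise.countable_of_isOpen_disjoint (s := fun i => Metric.ball (e i) (1 / 2)) ?_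
    (fun _ => Metric.isOpen_ball) fun _ => Metric.nonempty_ball.2 one_half_pos
  intro i j hij
  refine Metric.ball_disjoint_ball ?_
  have hsq : dist (e i) (e j) ^ 2 = 2 := by
    rw [dist_eq_norm, norm_sub_sq (𝕜 := 𝕜), he.1, he.1, he.2 hij, map_zero]
    norm_num
  rw [add_halves]
  exact (sq_le_sq₀ zero_le_one dist_nonneg).1 (by rw [hsq]; norm_num)

lemma nonempty_hilbertBasis_nat (H : Type*) [NormedAddCommGroup H] [InnerProductSpace 𝕜 H]
    [CompleteSpace H] [TopologicalSpace.SeparableSpace H] (hH : ¬ FiniteDimensional 𝕜 H) :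
    Nonempty (HilbertBasis ℕ 𝕜 H) := by
  obtain ⟨s, b, -⟩ := exists_hilbertBasis 𝕜 H
  have : Countable s := countable_of_orthonormal b.orthonormal
  have : Infinite s := by
    refine not_finite_iff_infinite.1 fun _ => hH ?_
    have := Fintype.ofFinite s
    exact b.toOrthonormalBasis.toBasis.finiteDimensional_of_finite
  obtain ⟨e⟩ := nonempty_equiv_of_countable (α := ℕ) (β := s)
  exact ⟨HilbertBasis.mk (b.orthonormal.comp e e.injective)
    (by rw [e.surjective.range_comp, b.dense_span])⟩

lemma nonempty_linearIsometryEquiv_of_separableSpace (H K : Type*) [NormedAddCommGroup H]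
    [InnerProductSpace 𝕜 H] [CompleteSpace H] [TopologicalSpace.SeparableSpace H]
    [NormedAddCommGroup K] [InnerProductSpace 𝕜 K] [CompleteSpace K]
    [TopologicalSpace.SeparableSpace K]
    (hH : ¬ FiniteDimensional 𝕜 H) (hK : ¬ FiniteDimensional 𝕜 K) : Nonempty (H ≃ₗᵢ[𝕜] K) := by
  obtain ⟨b⟩ := nonempty_hilbertBasis_nat H hH
  obtain ⟨c⟩ := nonempty_hilbertBasis_nat K hK
  exact ⟨b.repr.trans c.repr.symm⟩

variable {ι : Type*} {G : ι → Type*}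

lemma separableSpace_lp [Countable ι] [∀ i, NormedAddCommGroup (G i)]
    [∀ i, TopologicalSpace.SeparableSpace (G i)] {p : ℝ≥0∞} [Fact (1 ≤ p)] (hp : p ≠ ∞) :
    TopologicalSpace.SeparableSpace (lp G p) := by
  classical
  rw [← TopologicalSpace.isSeparable_univ_iff]
  have hfinite : TopologicalSpace.IsSeparable
      (⋃ s : Finset ι, Set.range fun x : ∀ i, G i => ∑ i ∈ s, lp.single p i (x i)) :=
    .iUnion fun s => TopologicalSpace.isSeparable_range <| continuous_finsetSum s fun i _ =>
      (lp.isometry_single i).continuous.comp (continuous_apply i)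
  exact hfinite.closure.mono fun x _ => mem_closure_of_tendsto (lp.hasSum_single hp x)
    (.of_forall fun s => Set.mem_iUnion.2 ⟨s, ⇑x, rfl⟩)

variable (𝕜) in
lemma not_finiteDimensional_lp [Infinite ι] [∀ i, NormedAddCommGroup (G i)]
    [∀ i, NormedSpace 𝕜 (G i)] [∀ i, Nontrivial (G i)] {p : ℝ≥0∞} [Fact (1 ≤ p)] :
    ¬ FiniteDimensional 𝕜 (lp G p) := by
  classical
  intro h
  choose v hv using fun i => exists_ne (0 : G i)
  have hlinear : LinearIndependent 𝕜 fun i => (lp.single p i (v i) : lp G p) := by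
    refine linearIndependent_iff'.2 fun s c hc i hi => ?_
    have hcoord := congrArg (fun x : lp G p => x i) hc
    simp only [← lp.single_smul, lp.coeFn_sum, Finset.sum_apply, lp.coeFn_single,
      Finset.sum_pi_single, hi, if_true, lp.coeFn_zero, Pi.zero_apply] at hcoord
    exact (smul_eq_zero.1 hcoord).resolve_right (hv i)
  exact Infinite.not_finite (α := ι) hlinear.finite

end HilbertSpace

section DirectSum

variable {ι : Type*} {G : ι → Type*} [∀ i, NormedAddCommGroup (G i)]
  [∀ i, InnerProductSpace ℂ (G i)] [∀ i, CompleteSpace (G i)] {A : Type*} [CStarAlgebra A]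

/-- The Hilbert space direct sum of a family of representations, acting coordinatewise on the
Hilbert sum of the underlying spaces. -/
noncomputable def directSumRep (π : ∀ i, A →⋆ₐ[ℂ] (G i →L[ℂ] G i)) :
    A →⋆ₐ[ℂ] (lp G 2 →L[ℂ] lp G 2) where
  toFun a := lp.mapCLM 2 (fun i => π i a) (norm_nonneg a) fun i =>
    NonUnitalStarAlgHom.norm_apply_le (π i) a
  map_one' := by ext; simp
  map_mul' a b := by ext; simp
  map_zero' := by ext; simp
  map_add' a b := by ext; simp
  commutes' c := by ext; simp [Algebra.algebraMap_eq_smul_one]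
  map_star' a := by
    refine (ContinuousLinearMap.eq_adjoint_iff _ _).2 fun x y => ?_
    simp only [lp.inner_eq_tsum, lp.mapCLM_apply_coe, map_star,
      ContinuousLinearMap.star_eq_adjoint, ContinuousLinearMap.adjoint_inner_left]

@[simp] lemma directSumRep_apply (π : ∀ i, A →⋆ₐ[ℂ] (G i →L[ℂ] G i)) (a : A) (x : lp G 2) (i : ι) :
    directSumRep π a x i = π i a (x i) := rfl

lemma norm_apply_le_norm_directSumRep (π : ∀ i, A →⋆ₐ[ℂ] (G i →L[ℂ] G i)) (a : A) (i : ι) :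
    ‖π i a‖ ≤ ‖directSumRep π a‖ := by
  classical
  refine ContinuousLinearMap.opNorm_le_bound _ (norm_nonneg _) fun v => ?_
  calc ‖π i a v‖ = ‖directSumRep π a (lp.single 2 i v) i‖ := by simp
    _ ≤ ‖directSumRep π a (lp.single 2 i v)‖ := lp.norm_apply_le_norm two_ne_zero _ i
    _ ≤ ‖directSumRep π a‖ * ‖lp.single (E := G) 2 i v‖ := ContinuousLinearMap.le_opNorm _ _
    _ = ‖directSumRep π a‖ * ‖v‖ := by rw [lp.norm_single two_pos]

end DirectSum

section Representation

variable {A : Type*} [CStarAlgebra A]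

lemma injective_of_norm_le_norm_apply_of_dense {C : Type*} [CStarAlgebra C] {π : A →⋆ₐ[ℂ] C}
    {s : Set A} (hs : Dense s) (hπ : ∀ a ∈ s, ‖a‖ ≤ ‖π a‖) : Function.Injective π := by
  have hclosed : IsClosed {a | ‖a‖ ≤ ‖π a‖} := isClosed_le (by fun_prop) (by fun_prop)
  refine (injective_iff_map_eq_zero π).2 fun a ha => norm_le_zero_iff.1 ?_
  have hnorm : ‖a‖ ≤ ‖π a‖ := hclosed.closure_subset_iff.2 hπ (hs a)
  rwa [ha, norm_zero] at hnorm

lemma injective_directSumRep_of_denseRange {ι : Type*} {G : ι → Type*}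
    [∀ i, NormedAddCommGroup (G i)] [∀ i, InnerProductSpace ℂ (G i)] [∀ i, CompleteSpace (G i)]
    {π : ∀ i, A →⋆ₐ[ℂ] (G i →L[ℂ] G i)} {a : ι → A} (ha : DenseRange a)
    (hπ : ∀ i, ‖a i‖ ≤ ‖π i (a i)‖) : Function.Injective (directSumRep π) :=
  injective_of_norm_le_norm_apply_of_dense ha <| Set.forall_mem_range.2 fun i =>
    (hπ i).trans (norm_apply_le_norm_directSumRep π (a i) i)

attribute [local instance] CStarAlgebra.spectralOrder CStarAlgebra.spectralOrderedRing

lemma exists_norm_le_norm_gnsStarAlgHom [Nontrivial A] (a : A) :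
    ∃ φ : StateSpace A, ‖a‖ ≤ ‖φ.toPositive.gnsStarAlgHom a‖ := by
  obtain ⟨φ, hφ⟩ := exists_norm_state_apply_eq (IsSelfAdjoint.star_mul_self a)
  have hsq : ‖φ.toPositive.gnsStarAlgHom a φ.cyclicVector‖ ^ 2 = ‖a‖ ^ 2 := by
    rw [φ.norm_gnsStarAlgHom_cyclicVector_sq, ← Complex.norm_of_nonneg' (φ.2.2 a),
      Complex.ofReal_re, hφ, CStarRing.norm_star_mul_self, sq]
  refine ⟨φ, ?_⟩
  rw [← (sq_eq_sq₀ (norm_nonneg _) (norm_nonneg _)).1 hsq]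
  exact φ.norm_gnsStarAlgHom_cyclicVector_le a

theorem exists_injective_representation [Nontrivial A] [TopologicalSpace.SeparableSpace A]
    (H : Type*) [NormedAddCommGroup H] [InnerProductSpace ℂ H] [CompleteSpace H]
    [TopologicalSpace.SeparableSpace H] (hH : ¬ FiniteDimensional ℂ H) :
    ∃ π : A →⋆ₐ[ℂ] (H →L[ℂ] H), Function.Injective π := by
  choose φ hφ using fun n => exists_norm_le_norm_gnsStarAlgHom (TopologicalSpace.denseSeq A n)
  let G (n : ℕ) := (φ n).toPositive.GNS
  have hinj : Function.Injective (directSumRep (G := G) fun n => (φ n).toPositive.gnsStarAlgHom) :=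
    injective_directSumRep_of_denseRange (TopologicalSpace.denseRange_denseSeq A) hφ
  have : TopologicalSpace.SeparableSpace (lp G 2) := separableSpace_lp ENNReal.ofNat_ne_top
  have hG : ¬ FiniteDimensional ℂ (lp G 2) := not_finiteDimensional_lp ℂ
  obtain ⟨e⟩ := nonempty_linearIsometryEquiv_of_separableSpace (lp G 2) H hG hH
  exact ⟨(e.conjStarAlgEquiv : (lp G 2 →L[ℂ] lp G 2) →⋆ₐ[ℂ] (H →L[ℂ] H)).comp (directSumRep _),
    e.conjStarAlgEquiv.injective.comp hinj⟩

end Representation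

end QuantumMetric

theorem mainTheorem8_general {A : Type u} {B : Type v} [CStarAlgebra A] [CStarAlgebra B]
    [Nontrivial A] [Nontrivial B]
    (F : ℝ≥0 → ℝ≥0 → ℝ≥0 → ℝ≥0 → ℝ≥0) (hF : IsPermissible F)
    (LA : PartialSeminorm A) (LB : PartialSeminorm B)
    (hA : IsQuantumCompactMetricSpace F LA) (hB : IsQuantumCompactMetricSpace F LB)
    (D : ℝ≥0∞) (hD : D = max (stateDiam LA) (stateDiam LB)) :
    D < ∞ ∧
    (∀ ε : ℝ≥0, 0 < D + ε →
      ∃ (E : Type (max u v)) (_ : CStarAlgebra E) (L : PartialSeminorm E)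
        (π₁ : E →⋆ₐ[ℂ] A) (π₂ : E →⋆ₐ[ℂ] B),
        IsTunnel F LA LB L π₁ π₂ ∧ extent L π₁ π₂ ≤ D + ε) ∧
    (∀ (H : Type w) [NormedAddCommGroup H] [InnerProductSpace ℂ H] [CompleteSpace H]
      [TopologicalSpace.SeparableSpace H], ¬ FiniteDimensional ℂ H →
      (∃ πA : A →⋆ₐ[ℂ] (H →L[ℂ] H), Function.Injective πA) ∧
      ∃ πB : B →⋆ₐ[ℂ] (H →L[ℂ] H), Function.Injective πB) ∧
    (∀ (H : Type w) [NormedAddCommGroup H] [InnerProductSpace ℂ H] [CompleteSpace H] [Nontrivial H]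
      (πA : A →⋆ₐ[ℂ] (H →L[ℂ] H)) (πB : B →⋆ₐ[ℂ] (H →L[ℂ] H)) (ε : ℝ≥0), 0 < D + ε →
      IsTunnel F LA LB (glue LA LB πA πB (D + ε))
        (StarAlgHom.fst ℂ A B) (StarAlgHom.snd ℂ A B) ∧
      (Function.Injective πA → Function.Injective πB →
        extent (glue LA LB πA πB (D + ε))
          (StarAlgHom.fst ℂ A B) (StarAlgHom.snd ℂ A B) ≤ D + ε)) := by
  have hfin : D < ∞ := hD ▸ max_lt hA.stateDiam_lt_top hB.stateDiam_lt_top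
  have hadd (ε : ℝ≥0) : D + ε ≠ ∞ := ENNReal.add_ne_top.2 ⟨hfin.ne, ENNReal.coe_ne_top⟩
  have hDA (ε : ℝ≥0) : stateDiam LA ≤ D + ε := (hD ▸ le_max_left _ _).trans le_self_add
  have hDB (ε : ℝ≥0) : stateDiam LB ≤ D + ε := (hD ▸ le_max_right _ _).trans le_self_add
  have := hA.separableSpace
  have := hB.separableSpace
  refine ⟨hfin, fun ε hε => ?_, fun H _ _ _ _ hH =>
    ⟨exists_injective_representation H hH, exists_injective_representation H hH⟩,
    fun H _ _ _ _ πA πB ε hε => ⟨isTunnel_glue hF hA hB hε.ne' (hadd ε) (hDA ε) (hDB ε),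
      fun hπA hπB => extent_glue_le hπA hπB hε.ne' (hadd ε)⟩⟩
  have hℓ : ¬ FiniteDimensional ℂ (lp (fun _ : ℕ => ℂ) 2) := not_finiteDimensional_lp ℂ
  have := separableSpace_lp (G := fun _ : ℕ => ℂ) (ENNReal.ofNat_ne_top (n := 2))
  obtain ⟨πA, hπA⟩ := exists_injective_representation (A := A) _ hℓ
  obtain ⟨πB, hπB⟩ := exists_injective_representation (A := B) _ hℓ
  have : Nontrivial (lp (fun _ : ℕ => ℂ) 2) :=
    not_subsingleton_iff_nontrivial.1 fun _ => hℓ inferInstance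
  exact ⟨A × B, inferInstance, glue LA LB πA πB (D + ε), StarAlgHom.fst ℂ A B,
    StarAlgHom.snd ℂ A B, isTunnel_glue hF hA hB hε.ne' (hadd ε) (hDA ε) (hDB ε),
    extent_glue_le hπA hπB hε.ne' (hadd ε)⟩

theorem mainTheorem8 {A : Type u} {B : Type v} [CStarAlgebra A] [CStarAlgebra B]
    [Nontrivial A] [Nontrivial B]
    (F : ℝ≥0 → ℝ≥0 → ℝ≥0 → ℝ≥0 → ℝ≥0) (hF : IsPermissible F)
    (LA : PartialSeminorm A) (LB : PartialSeminorm B)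
    (hA : IsQuantumCompactMetricSpace F LA) (hB : IsQuantumCompactMetricSpace F LB)
    (D : ℝ≥0∞) (hD : D = max (stateDiam LA) (stateDiam LB)) :
    D < ∞ ∧
    (∀ ε : ℝ≥0, 0 < D + ε →
      ∃ (E : Type (max u v)) (_ : CStarAlgebra E) (L : PartialSeminorm E)
        (π₁ : E →⋆ₐ[ℂ] A) (π₂ : E →⋆ₐ[ℂ] B),
        IsTunnel F LA LB L π₁ π₂ ∧ extent L π₁ π₂ ≤ D + ε) ∧
    (∀ (H : Type w) [NormedAddCommGroup H] [InnerProductSpace ℂ H] [CompleteSpace H]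
      [TopologicalSpace.SeparableSpace H], ¬ FiniteDimensional ℂ H →
      (∃ πA : A →⋆ₐ[ℂ] (H →L[ℂ] H), Function.Injective πA) ∧
      (∃ πB : B →⋆ₐ[ℂ] (H →L[ℂ] H), Function.Injective πB) ∧
      ∀ (πA : A →⋆ₐ[ℂ] (H →L[ℂ] H)) (πB : B →⋆ₐ[ℂ] (H →L[ℂ] H)),
        Function.Injective πA → Function.Injective πB → ∀ ε : ℝ≥0, 0 < D + ε →
          IsTunnel F LA LB (glue LA LB πA πB (D + ε))
            (StarAlgHom.fst ℂ A B) (StarAlgHom.snd ℂ A B) ∧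
          extent (glue LA LB πA πB (D + ε))
            (StarAlgHom.fst ℂ A B) (StarAlgHom.snd ℂ A B) ≤ D + ε) := by
  obtain ⟨hfin, htunnel, hrep, hglue⟩ := mainTheorem8_general F hF LA LB hA hB D hD
  refine ⟨hfin, htunnel, fun H _ _ _ _ hH => ⟨(hrep H hH).1, (hrep H hH).2,
    fun πA πB hπA hπB ε hε => ?_⟩⟩
  have : Nontrivial H := not_subsingleton_iff_nontrivial.1 fun _ => hH inferInstance
  exact (hglue H πA πB ε hε).imp_right fun h => h hπA hπB
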